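/- Let $P \subset \mathbb{R}^{d}$ be a closed convex cone that is spanning ($P - P = \mathbb{R}^{d}$) and pointed ($P \cap -P = \{0\}$), and let $K$ be a separable complex Hilbert space, with inner product linear in the second variable. An isometric representation of $P$ on $K$ is a map $V : P \to B(K)$ such that every $V_x$ is an isometry, $V_{x+y} = V_x V_y$ for all $x, y \in P$, and $x \mapsto V_x \xi$ is continuous for every $\xi \in K$. For a Hilbert space $H$, an $\mathrm{E}_0$-semigroup over $P$ on $B(H)$ is a family $\alpha = \{\alpha_x\}_{x \in P}$ of normal unital $*$-endomorphisms of $B(H)$ with $\alpha_x \circ \alpha_y = \alpha_{x+y}$ for $x, y \in P$, $\alpha_0 = \mathrm{Id}$, and such that $x \mapsto \rho(\alpha_x(T))$ is continuous on $P$ for every $T \in B(H)$ and every $\rho$ in the predual $B(H)_*$. Let $\Gamma(K) = \bigoplus_{n \ge 0} K^{\otimes_s n}$ be the symmetric Fock space, let $e(u) = \sum_{n \ge 0} u^{\otimes n}/\sqrt{n!}$ be the exponential vectors, and let $W(u)$, $u \in K$, be the Weyl operators, the unitary operators on $\Gamma(K)$ determined by $W(u) e(v) = e^{-\|u\|^{2}/2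 - \langle u | v \rangle}\, e(u + v)$ for $v \in K$. Then for every isometric representation $V$ of $P$ on $K$ there exists a unique $\mathrm{E}_0$-semigroup $\alpha^{V} = \{\alpha^{V}_x\}_{x \in P}$ over $P$ on $B(\Gamma(K))$ satisfying $$\alpha^{V}_x(W(u)) = W(V_x u) \qquad \text{for all } x \in P,\ u \in K.$$ It is called the CCR flow associated to $V$. -/

import Mathlib

noncomputable section

namespace CCR

open scoped InnerProductSpace Matrix ComplexOrder

variable (K : Type*) [NormedAddCommGroup K] [InnerProductSpace ℂ K]

/-- The algebraic `n`-fold tensor power of `K` over `ℂ`. It is a type of its own, so that it can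
carry the Hilbert space (semi)norm. -/
def AlgTensorPower (n : ℕ) : Type _ := PiTensorProduct ℂ (fun _ : Fin n => K)

instance (n : ℕ) : AddCommGroup (AlgTensorPower K n) :=
  inferInstanceAs (AddCommGroup (PiTensorProduct ℂ (fun _ : Fin n => K)))

instance (n : ℕ) : Module ℂ (AlgTensorPower K n) :=
  inferInstanceAs (Module ℂ (PiTensorProduct ℂ (fun _ : Fin n => K)))

variable {K}

/-- The elementary tensor `x₀ ⊗ ⋯ ⊗ xₙ₋₁`. -/
def algTprod (n : ℕ) : MultilinearMap ℂ (fun _ : Fin n => K) (AlgTensorPower K n) :=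
  PiTensorProduct.tprod ℂ

theorem algTprod_span (n : ℕ) :
    Submodule.span ℂ (Set.range (algTprod (K := K) n)) = ⊤ :=
  PiTensorProduct.span_tprod_eq_top

/-- The linear functional `y₀ ⊗ ⋯ ⊗ yₙ₋₁ ↦ ∏ᵢ ⟪xᵢ, yᵢ⟫`. -/
def pairLeft {n : ℕ} (x : Fin n → K) : AlgTensorPower K n →ₗ[ℂ] ℂ :=
  PiTensorProduct.lift
    ((MultilinearMap.mkPiRing ℂ (Fin n) (1 : ℂ)).compLinearMap
      (fun i => (innerSL ℂ (x i)).toLinearMap))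

theorem pairLeft_tprod {n : ℕ} (x y : Fin n → K) :
    pairLeft x (algTprod n y) = ∏ i, ⟪x i, y i⟫_ℂ := by
  refine (PiTensorProduct.lift.tprod _).trans ?_
  simp

theorem pairLeft_ext {n : ℕ} {f g : AlgTensorPower K n →ₗ[ℂ] ℂ}
    (h : ∀ y, f (algTprod n y) = g (algTprod n y)) : f = g :=
  PiTensorProduct.ext (MultilinearMap.ext h)

/-- The conjugate-linear functional `x ↦ ⟪x, y₀ ⊗ ⋯ ⊗ yₙ₋₁⟫`, as a multilinear function of `y`. -/
def pairRight (n : ℕ) :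
    MultilinearMap ℂ (fun _ : Fin n => K) (AlgTensorPower K n →ₗ⋆[ℂ] ℂ) where
  toFun y :=
    { toFun := fun x => starRingEnd ℂ (pairLeft y x)
      map_add' := fun a b => by simp
      map_smul' := fun c a => by simp }
  map_update_add' {inst} y i a b := by
    obtain rfl : inst = instDecidableEqFin n := Subsingleton.elim _ _
    have h : pairLeft (Function.update y i (a + b)) =
        pairLeft (Function.update y i a) + pairLeft (Function.update y i b) := by
      refine pairLeft_ext fun z => ?_
      rw [LinearMap.add_apply]
      simp only [pairLeft_tprod]
      simp only [← Finset.mul_prod_erase Finset.univ _ (Finset.mem_univ i), Function.update_self,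
        inner_add_left, add_mul]
      congr 2 <;>
      · refine Finset.prod_congr rfl fun j hj => ?_
        simp [Function.update_of_ne (Finset.ne_of_mem_erase hj)]
    ext x
    simp [h]
  map_update_smul' {inst} y i c a := by
    obtain rfl : inst = instDecidableEqFin n := Subsingleton.elim _ _
    have h : pairLeft (Function.update y i (c • a)) =
        starRingEnd ℂ c • pairLeft (Function.update y i a) := by
      refine pairLeft_ext fun z => ?_
      rw [LinearMap.smul_apply]
      simp only [pairLeft_tprod]
      simp only [← Finset.mul_prod_erase Finset.univ _ (Finset.mem_univ i), Function.update_self,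
        inner_smul_left, smul_eq_mul, mul_assoc]
      congr 2
      refine Finset.prod_congr rfl fun j hj => ?_
      simp [Function.update_of_ne (Finset.ne_of_mem_erase hj)]
    ext x
    simp [h]

/-- The sesquilinear form on the tensor power, linear in the first argument written here. -/
def tensorForm (n : ℕ) : AlgTensorPower K n →ₗ[ℂ] AlgTensorPower K n →ₗ⋆[ℂ] ℂ :=
  PiTensorProduct.lift (pairRight n)

theorem tensorForm_tprod {n : ℕ} (x y : Fin n → K) :
    tensorForm n (algTprod n y) (algTprod n x) = ∏ i, ⟪x i, y i⟫_ℂ := by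
  have : tensorForm n (algTprod n y) = pairRight n y := PiTensorProduct.lift.tprod _
  rw [this]
  change starRingEnd ℂ (pairLeft y (algTprod n x)) = _
  simp [pairLeft_tprod]

theorem exists_sum_tprod {n : ℕ} (x : AlgTensorPower K n) :
    ∃ (m : ℕ) (c : Fin m → ℂ) (v : Fin m → Fin n → K), x = ∑ j, c j • algTprod n (v j) := by
  have hx : x ∈ Submodule.span ℂ (Set.range (algTprod (K := K) n)) := by
    rw [algTprod_span]; trivial
  obtain ⟨m, c, g, h⟩ := (Submodule.mem_span_set' (s := Set.range (algTprod (K := K) n))).1 hx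
  choose v hv using fun j => (g j).2
  exact ⟨m, c, v, by rw [← h]; simp [hv]⟩

theorem posSemidef_prod_inner {n m : ℕ} (v : Fin m → Fin n → K) :
    (Matrix.of fun j k => ∏ i, ⟪v j i, v k i⟫_ℂ).PosSemidef := by
  classical
  have key : ∀ s : Finset (Fin n),
      (Matrix.of fun j k => ∏ i ∈ s, ⟪v j i, v k i⟫_ℂ).PosSemidef := by
    intro s
    induction s using Finset.induction_on with
    | empty =>
      have h : (Matrix.of fun _ _ : Fin m => ∏ i ∈ (∅ : Finset (Fin n)), (1 : ℂ)) =
          Matrix.gram ℂ (fun _ : Fin m => (1 : ℂ)) := by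
        ext j k; simp [Matrix.gram]
      have h' := Matrix.posSemidef_gram ℂ (fun _ : Fin m => (1 : ℂ))
      rw [← h] at h'
      simpa using h'
    | insert a s ha ih =>
      have h := (Matrix.posSemidef_gram ℂ (fun j => v j a)).hadamard ih
      have e : (Matrix.of fun j k => ∏ i ∈ insert a s, ⟪v j i, v k i⟫_ℂ) =
          (Matrix.gram ℂ fun j => v j a) ⊙ Matrix.of fun j k => ∏ i ∈ s, ⟪v j i, v k i⟫_ℂ := by
        ext j k
        simp [Finset.prod_insert ha, Matrix.hadamard]
      rw [e]
      exact h
  exact key Finset.univ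

theorem tensorForm_conj {n : ℕ} (x y : AlgTensorPower K n) :
    starRingEnd ℂ (tensorForm n x y) = tensorForm n y x := by
  obtain ⟨m, c, v, rfl⟩ := exists_sum_tprod x
  obtain ⟨m', c', v', rfl⟩ := exists_sum_tprod y
  simp only [map_sum, map_smul, LinearMap.map_smulₛₗ, LinearMap.sum_apply, LinearMap.smul_apply,
    tensorForm_tprod, smul_eq_mul, map_mul, map_prod, inner_conj_symm, Complex.conj_conj,
    Finset.mul_sum]
  rw [Finset.sum_comm]
  refine Finset.sum_congr rfl fun j _ => Finset.sum_congr rfl fun k _ => by ring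

theorem tensorForm_nonneg {n : ℕ} (x : AlgTensorPower K n) :
    0 ≤ (tensorForm n x x).re := by
  obtain ⟨m, c, v, rfl⟩ := exists_sum_tprod x
  have h := (posSemidef_prod_inner v).dotProduct_mulVec_nonneg c
  have h2 := (Complex.le_def.1 h).1
  refine h2.trans (le_of_eq ?_)
  congr 1
  simp only [map_sum, map_smul, LinearMap.map_smulₛₗ, LinearMap.sum_apply, LinearMap.smul_apply,
    tensorForm_tprod, smul_eq_mul, dotProduct, Matrix.mulVec, Matrix.of_apply, Pi.star_apply,
    Finset.mul_sum]
  refine Finset.sum_congr rfl fun j _ => Finset.sum_congr rfl fun k _ => ?_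
  simp only [RCLike.star_def]
  ring

instance (n : ℕ) : PreInnerProductSpace.Core ℂ (AlgTensorPower K n) where
  inner x y := tensorForm n y x
  conj_inner_symm x y := tensorForm_conj _ _
  re_inner_nonneg x := tensorForm_nonneg x
  add_left x y z := by simp
  smul_left x y c := by simp

instance (n : ℕ) : SeminormedAddCommGroup (AlgTensorPower K n) :=
  InnerProductSpace.Core.toSeminormedAddCommGroup (𝕜 := ℂ)

instance (n : ℕ) : InnerProductSpace ℂ (AlgTensorPower K n) := .ofCore _

theorem inner_algTprod {n : ℕ} (x y : Fin n → K) :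
    ⟪algTprod n x, algTprod n y⟫_ℂ = ∏ i, ⟪x i, y i⟫_ℂ :=
  tensorForm_tprod x y

variable (K) in
/-- The Hilbert space tensor power `K^{⊗n}`, the completion of the algebraic tensor power for
`⟪x₀ ⊗ ⋯, y₀ ⊗ ⋯⟫ = ∏ᵢ ⟪xᵢ, yᵢ⟫`. -/
def TensorPower (n : ℕ) : Type _ := UniformSpace.Completion (AlgTensorPower K n)

instance (n : ℕ) : NormedAddCommGroup (TensorPower K n) :=
  inferInstanceAs (NormedAddCommGroup (UniformSpace.Completion (AlgTensorPower K n)))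

instance (n : ℕ) : InnerProductSpace ℂ (TensorPower K n) :=
  inferInstanceAs (InnerProductSpace ℂ (UniformSpace.Completion (AlgTensorPower K n)))

instance (n : ℕ) : CompleteSpace (TensorPower K n) :=
  inferInstanceAs (CompleteSpace (UniformSpace.Completion (AlgTensorPower K n)))

/-- The canonical map from the algebraic tensor power to its completion. -/
def toTensorPower (n : ℕ) : AlgTensorPower K n →ₗᵢ[ℂ] TensorPower K n :=
  UniformSpace.Completion.toComplₗᵢ

theorem denseRange_toTensorPower (n : ℕ) : DenseRange (toTensorPower (K := K) n) :=
  UniformSpace.Completion.denseRange_coe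

/-- The elementary tensor in the Hilbert space tensor power. -/
def tprod {n : ℕ} (x : Fin n → K) : TensorPower K n := toTensorPower n (algTprod n x)

theorem inner_tprod {n : ℕ} (x y : Fin n → K) :
    ⟪tprod x, tprod y⟫_ℂ = ∏ i, ⟪x i, y i⟫_ℂ := by
  rw [tprod, tprod, LinearIsometry.inner_map_map, inner_algTprod]

/-- The permutation `x₀ ⊗ ⋯ ⊗ xₙ₋₁ ↦ x_{σ⁻¹ 0} ⊗ ⋯ ⊗ x_{σ⁻¹ (n-1)}` of the tensor factors. -/
def algPerm {n : ℕ} (σ : Equiv.Perm (Fin n)) : AlgTensorPower K n →ₗ[ℂ] AlgTensorPower K n :=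
  (PiTensorProduct.reindex ℂ (fun _ => K) σ).toLinearMap

theorem algPerm_tprod {n : ℕ} (σ : Equiv.Perm (Fin n)) (x : Fin n → K) :
    algPerm σ (algTprod n x) = algTprod n (fun i => x (σ.symm i)) :=
  PiTensorProduct.reindex_tprod σ x

theorem inner_algPerm {n : ℕ} (σ : Equiv.Perm (Fin n)) (x y : AlgTensorPower K n) :
    ⟪algPerm σ x, algPerm σ y⟫_ℂ = ⟪x, y⟫_ℂ := by
  obtain ⟨m, c, v, rfl⟩ := exists_sum_tprod x
  obtain ⟨m', c', v', rfl⟩ := exists_sum_tprod y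
  simp only [map_sum, map_smul, algPerm_tprod, sum_inner, inner_sum, inner_smul_left,
    inner_smul_right, inner_algTprod]
  refine Finset.sum_congr rfl fun j _ => congrArg _ (Finset.sum_congr rfl fun k _ => congrArg _ ?_)
  exact Equiv.prod_comp σ.symm (fun i => ⟪v k i, v' j i⟫_ℂ)

/-- The unitary on `K^{⊗n}` that permutes the tensor factors by `σ`. -/
def permOp {n : ℕ} (σ : Equiv.Perm (Fin n)) : TensorPower K n →L[ℂ] TensorPower K n :=
  ((algPerm σ).isometryOfInner (inner_algPerm σ)).toContinuousLinearMap.completion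

theorem permOp_tprod {n : ℕ} (σ : Equiv.Perm (Fin n)) (x : Fin n → K) :
    permOp σ (tprod x) = tprod (fun i => x (σ.symm i)) := by
  refine (ContinuousLinearMap.completion_apply_coe _ _).trans ?_
  exact congrArg (toTensorPower n) (algPerm_tprod σ x)

theorem inner_permOp {n : ℕ} (σ : Equiv.Perm (Fin n)) (x y : TensorPower K n) :
    ⟪permOp σ x, permOp σ y⟫_ℂ = ⟪x, y⟫_ℂ := by
  have h : ∀ a : AlgTensorPower K n,
      permOp σ (toTensorPower n a) = toTensorPower n (algPerm σ a) := fun a =>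
    ContinuousLinearMap.completion_apply_coe _ _
  refine (denseRange_toTensorPower n).induction_on₂
    (isClosed_eq (by fun_prop) (by fun_prop)) (fun a b => ?_) x y
  rw [h, h, LinearIsometry.inner_map_map, LinearIsometry.inner_map_map, inner_algPerm]

variable (K) in
/-- The symmetric tensor power: the vectors of `K^{⊗n}` fixed by all permutations of the
factors. -/
def SymPower (n : ℕ) : Submodule ℂ (TensorPower K n) :=
  ⨅ σ : Equiv.Perm (Fin n), LinearMap.eqLocus (permOp σ).toLinearMap LinearMap.id

theorem mem_symPower {n : ℕ} {x : TensorPower K n} :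
    x ∈ SymPower K n ↔ ∀ σ : Equiv.Perm (Fin n), permOp σ x = x := by
  simp [SymPower, Submodule.mem_iInf, LinearMap.mem_eqLocus]

instance (n : ℕ) : CompleteSpace (SymPower K n) := by
  suffices h : IsClosed (SymPower K n : Set (TensorPower K n)) from h.completeSpace_coe
  have : (SymPower K n : Set (TensorPower K n)) =
      ⋂ σ : Equiv.Perm (Fin n), {x | permOp σ x = x} := by
    ext x; simp [mem_symPower]
  rw [this]
  exact isClosed_iInter fun σ => isClosed_eq (permOp σ).continuous continuous_id

variable (K) in
/-- The symmetric Fock space `Γ(K)`, the Hilbert space direct sum of the symmetric tensor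
powers. -/
abbrev Fock : Type _ := lp (fun n : ℕ => SymPower K n) 2

/-- `u^{⊗n}`. -/
def tpow (n : ℕ) (u : K) : SymPower K n :=
  ⟨tprod (fun _ => u), mem_symPower.2 fun σ => permOp_tprod σ _⟩

theorem inner_tpow (n : ℕ) (u v : K) : ⟪tpow n u, tpow n v⟫_ℂ = ⟪u, v⟫_ℂ ^ n := by
  rw [Submodule.coe_inner, tpow, tpow, inner_tprod]
  simp

theorem norm_tpow (n : ℕ) (u : K) : ‖tpow n u‖ = ‖u‖ ^ n := by
  have h := inner_tpow n u u
  rw [inner_self_eq_norm_sq_to_K, inner_self_eq_norm_sq_to_K, ← pow_mul, mul_comm 2 n,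
    pow_mul] at h
  have h' : ‖tpow n u‖ ^ 2 = (‖u‖ ^ n) ^ 2 := by exact_mod_cast h
  exact (pow_left_inj₀ (norm_nonneg _) (by positivity) two_ne_zero).1 h'

theorem memℓp_expVec (u : K) :
    Memℓp (fun n : ℕ => ((Real.sqrt n.factorial : ℂ)⁻¹ • tpow n u : SymPower K n)) 2 := by
  refine memℓp_gen ?_
  have h := Real.summable_pow_div_factorial (‖u‖ ^ 2)
  refine h.congr fun n => ?_
  rw [norm_smul, norm_tpow]
  simp only [ENNReal.toReal_ofNat, Real.rpow_ofNat, norm_inv, Complex.norm_real, Real.norm_eq_abs]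
  rw [abs_of_nonneg (Real.sqrt_nonneg _), mul_pow, inv_pow, Real.sq_sqrt (by positivity)]
  rw [← pow_mul, ← pow_mul, mul_comm n 2]
  field_simp

/-- The exponential vector `e(u) = ∑ₙ u^{⊗n} / √n!`. -/
def expVec (u : K) : Fock K :=
  ⟨fun n => (Real.sqrt n.factorial : ℂ)⁻¹ • tpow n u, memℓp_expVec u⟩

theorem expVec_apply (u : K) (n : ℕ) :
    (expVec u : Fock K) n = (Real.sqrt n.factorial : ℂ)⁻¹ • tpow n u := rfl

theorem inner_expVec (u v : K) : ⟪expVec u, expVec v⟫_ℂ = Complex.exp ⟪u, v⟫_ℂ := by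
  rw [lp.inner_eq_tsum, Complex.exp_eq_exp_ℂ, NormedSpace.exp_eq_tsum_div]
  refine tsum_congr fun n => ?_
  rw [expVec_apply, expVec_apply, inner_smul_left, inner_smul_right, inner_tpow]
  have h : (Real.sqrt n.factorial : ℂ) * (Real.sqrt n.factorial : ℂ) = (n.factorial : ℂ) := by
    rw [← Complex.ofReal_mul, Real.mul_self_sqrt (by positivity)]; simp
  have h0 : (Real.sqrt n.factorial : ℂ) ≠ 0 := by
    exact_mod_cast (Real.sqrt_pos.2 (Nat.cast_pos.2 n.factorial_pos)).ne'
  simp only [map_inv₀, Complex.conj_ofReal]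
  rw [← h]
  field_simp

theorem tpow_smul (n : ℕ) (z : ℂ) (u : K) : tpow n (z • u) = z ^ n • tpow n u := by
  apply Subtype.ext
  change tprod (fun _ => z • u) = z ^ n • tprod (fun _ => u)
  rw [tprod, tprod, ← map_smul]
  congr 1
  have h := (algTprod (K := K) n).map_smul_univ (fun _ => z) (fun _ => u)
  simpa using h

/-- Polarization: a symmetric tensor orthogonal to all `u^{⊗n}` vanishes. -/
theorem eq_zero_of_inner_tpow {n : ℕ} (ξ : SymPower K n) (h : ∀ u : K, ⟪ξ, tpow n u⟫_ℂ = 0) :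
    ξ = 0 := by
  let f : MultilinearMap ℂ (fun _ : Fin n => K) ℂ :=
    ((innerSL ℂ (ξ : TensorPower K n)).toLinearMap ∘ₗ
      (toTensorPower n).toLinearMap).compMultilinearMap (algTprod n)
  have hf : ∀ x, f x = ⟪(ξ : TensorPower K n), tprod x⟫_ℂ := fun x => rfl
  have hnorm : ∀ x : Fin n → K, ‖tprod x‖ = ∏ i, ‖x i‖ := fun x => by
    have h1 := inner_tprod x x
    simp only [inner_self_eq_norm_sq_to_K] at h1
    rw [Finset.prod_pow] at h1
    have h2 : ‖tprod x‖ ^ 2 = (∏ i, ‖x i‖) ^ 2 := by exact_mod_cast h1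
    exact (pow_left_inj₀ (norm_nonneg _)
      (Finset.prod_nonneg fun _ _ => norm_nonneg _) two_ne_zero).1 h2
  let F := f.mkContinuous ‖(ξ : TensorPower K n)‖ (fun x => by
    rw [hf, ← hnorm]; exact norm_inner_le_norm _ _)
  have hF : ∀ x, F x = ⟪(ξ : TensorPower K n), tprod x⟫_ℂ := fun x => rfl
  have hdiag : (fun u : K => F (fun _ => u)) = fun _ => 0 := by
    funext u
    exact (hF _).trans (h u)
  have hzero : ∀ x : Fin n → K, ⟪(ξ : TensorPower K n), tprod x⟫_ℂ = 0 := by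
    intro x
    have h1 := F.iteratedFDeriv_comp_diagonal 0 x
    rw [hdiag] at h1
    have h2 : iteratedFDeriv ℂ n (fun _ : K => (0 : ℂ)) 0 x = 0 := by
      have : iteratedFDeriv ℂ n (fun _ : K => (0 : ℂ)) = 0 := iteratedFDeriv_fun_zero
      rw [this]; rfl
    rw [h2] at h1
    have h3 : ∀ σ : Equiv.Perm (Fin n), F (fun i => x (σ i)) = F x := by
      intro σ
      rw [hF, hF]
      have h4 := permOp_tprod σ (fun i => x (σ i))
      simp only [Equiv.apply_symm_apply] at h4
      have h5 : ⟪permOp σ (ξ : TensorPower K n), permOp σ (tprod fun i => x (σ i))⟫_ℂ =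
          ⟪(ξ : TensorPower K n), tprod fun i => x (σ i)⟫_ℂ := inner_permOp σ _ _
      rw [h4, mem_symPower.1 ξ.2 σ] at h5
      exact h5.symm
    rw [Finset.sum_congr rfl (fun σ _ => h3 σ)] at h1
    simp only [Finset.sum_const, nsmul_eq_mul] at h1
    have h6 : ((Finset.univ : Finset (Equiv.Perm (Fin n))).card : ℂ) ≠ 0 := by
      simp [Fintype.card_perm, Nat.factorial_ne_zero]
    exact (mul_eq_zero.1 h1.symm).resolve_left h6
  have hall : ∀ y : AlgTensorPower K n, ⟪(ξ : TensorPower K n), toTensorPower n y⟫_ℂ = 0 := by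
    intro y
    obtain ⟨m, c, v, rfl⟩ := exists_sum_tprod y
    simp only [map_sum, map_smul, inner_sum, inner_smul_right]
    exact Finset.sum_eq_zero fun j _ => by
      have := hzero (v j)
      rw [tprod] at this
      rw [this, mul_zero]
  apply Subtype.ext
  exact (denseRange_toTensorPower n).eq_zero_of_inner_left ℂ hall

theorem eq_zero_of_inner_expVec (ξ : Fock K) (h : ∀ u : K, ⟪ξ, expVec u⟫_ℂ = 0) : ξ = 0 := by
  ext1
  funext n
  refine eq_zero_of_inner_tpow _ fun u => ?_
  let g : ℕ → ℂ := fun n => (Real.sqrt n.factorial : ℂ)⁻¹ * ⟪ξ n, tpow n u⟫_ℂ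
  have hs : ∀ z : ℂ, HasSum (fun n => z ^ n • g n) 0 := by
    intro z
    have h1 := lp.hasSum_inner (𝕜 := ℂ) ξ (expVec (z • u))
    rw [h] at h1
    refine h1.congr_fun ?_
    intro n
    rw [expVec_apply, inner_smul_right, tpow_smul, inner_smul_right]
    simp only [g, smul_eq_mul]
    ring
  have hp : HasFPowerSeriesAt (0 : ℂ → ℂ) (FormalMultilinearSeries.ofScalars ℂ g) 0 := by
    rw [hasFPowerSeriesAt_iff]
    refine Filter.Eventually.of_forall fun z => ?_
    simpa [FormalMultilinearSeries.coeff_ofScalars] using hs z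
  have h0 := hp.eq_zero
  have h1 : g n = 0 := by
    rw [← FormalMultilinearSeries.coeff_ofScalars (𝕜 := ℂ) (p := g) (n := n), h0]
    rfl
  have hne : (Real.sqrt n.factorial : ℂ)⁻¹ ≠ 0 := by
    rw [ne_eq, inv_eq_zero]
    exact_mod_cast (Real.sqrt_pos.2 (Nat.cast_pos.2 n.factorial_pos)).ne'
  exact (mul_eq_zero.1 h1).resolve_left hne

variable (K) in
/-- The linear map from formal linear combinations of vectors of `K` that sends `v` to `e(v)`. -/
def expComb : (K →₀ ℂ) →ₗ[ℂ] Fock K := Finsupp.linearCombination ℂ expVec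

theorem denseRange_expComb : DenseRange (expComb K) := by
  have h : (LinearMap.range (expComb K)).topologicalClosure = ⊤ := by
    rw [Submodule.topologicalClosure_eq_top_iff, Submodule.eq_bot_iff]
    intro ξ hξ
    refine eq_zero_of_inner_expVec ξ fun u => ?_
    exact Submodule.inner_left_of_mem_orthogonal
      (K := LinearMap.range (expComb K)) ⟨Finsupp.single u 1, by simp [expComb]⟩ hξ
  have h' := congrArg (fun S : Submodule ℂ (Fock K) => (S : Set (Fock K))) h
  simp only [Submodule.topologicalClosure_coe, Submodule.top_coe] at h'
  exact dense_iff_closure_eq.2 ((congrArg closure (LinearMap.coe_range _).symm).trans h')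

/-- The vector `e^{-‖u‖²/2 - ⟪u, v⟫} e(u + v)`. -/
def weylVec (u v : K) : Fock K :=
  Complex.exp (-((‖u‖ : ℂ) ^ 2) / 2 - ⟪u, v⟫_ℂ) • expVec (u + v)

theorem inner_weylVec (u v w : K) : ⟪weylVec u v, weylVec u w⟫_ℂ = ⟪expVec v, expVec w⟫_ℂ := by
  simp only [weylVec, inner_smul_left, inner_smul_right, inner_expVec, ← Complex.exp_conj,
    ← Complex.exp_add]
  congr 1
  simp only [map_sub, map_neg, map_div₀, map_pow, Complex.conj_ofReal, inner_conj_symm,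
    inner_add_left, inner_add_right, inner_self_eq_norm_sq_to_K, map_ofNat]
  simp only [Complex.coe_algebraMap]
  ring

theorem norm_linearCombination_weylVec (u : K) (x : K →₀ ℂ) :
    ‖Finsupp.linearCombination ℂ (weylVec u) x‖ = ‖expComb K x‖ := by
  have h : ⟪Finsupp.linearCombination ℂ (weylVec u) x,
      Finsupp.linearCombination ℂ (weylVec u) x⟫_ℂ = ⟪expComb K x, expComb K x⟫_ℂ := by
    simp only [expComb, Finsupp.linearCombination_apply, Finsupp.sum, sum_inner, inner_sum,
      inner_smul_left, inner_smul_right, inner_weylVec]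
  rw [inner_self_eq_norm_sq_to_K, inner_self_eq_norm_sq_to_K] at h
  have h2 : ‖Finsupp.linearCombination ℂ (weylVec u) x‖ ^ 2 = ‖expComb K x‖ ^ 2 := by
    exact_mod_cast h
  exact (pow_left_inj₀ (norm_nonneg _) (norm_nonneg _) two_ne_zero).1 h2

/-- The Weyl operator `W(u)`, the continuous linear extension of
`e(v) ↦ e^{-‖u‖²/2 - ⟪u, v⟫} e(u + v)`. -/
def weyl (u : K) : Fock K →L[ℂ] Fock K :=
  (Finsupp.linearCombination ℂ (weylVec u)).extendOfNorm (expComb K)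

theorem weyl_expVec (u v : K) :
    weyl u (expVec v) =
      Complex.exp (-((‖u‖ : ℂ) ^ 2) / 2 - ⟪u, v⟫_ℂ) • expVec (u + v) := by
  have h := LinearMap.extendOfNorm_eq (f := Finsupp.linearCombination ℂ (weylVec u))
    denseRange_expComb ⟨1, fun x => by rw [one_mul, norm_linearCombination_weylVec]⟩
    (Finsupp.single v 1)
  simpa [expComb, weyl, weylVec] using h

theorem clm_ext_expVec {E : Type*} [NormedAddCommGroup E] [NormedSpace ℂ E]
    {S T : Fock K →L[ℂ] E} (h : ∀ v : K, S (expVec v) = T (expVec v)) : S = T := by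
  have h' : S ∘ expComb K = T ∘ expComb K := by
    funext x
    simp [expComb, Finsupp.linearCombination_apply, Finsupp.sum, h]
  ext1 x
  exact congrFun (denseRange_expComb.equalizer S.continuous T.continuous h') x

theorem weyl_mul (u v : K) :
    weyl u * weyl v = Complex.exp (-((⟪u, v⟫_ℂ).im : ℂ) * Complex.I) • weyl (u + v) := by
  refine clm_ext_expVec fun w => ?_
  simp only [mul_apply_eq_comp, _root_.smul_apply, weyl_expVec, map_smul,
    smul_smul, ← Complex.exp_add, add_assoc]
  congr 2
  have e1 : ((‖u + v‖ : ℂ)) ^ 2 = ⟪u + v, u + v⟫_ℂ := (inner_self_eq_norm_sq_to_K (𝕜 := ℂ) (u + v)).symm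
  have e2 : ((‖u‖ : ℂ)) ^ 2 = ⟪u, u⟫_ℂ := (inner_self_eq_norm_sq_to_K (𝕜 := ℂ) (u)).symm
  have e3 : ((‖v‖ : ℂ)) ^ 2 = ⟪v, v⟫_ℂ := (inner_self_eq_norm_sq_to_K (𝕜 := ℂ) (v)).symm
  have e4 : ⟪v, u⟫_ℂ = starRingEnd ℂ ⟪u, v⟫_ℂ := (inner_conj_symm _ _).symm
  rw [e1, e2, e3]
  have r4 : (⟪v, u⟫_ℂ).re = (⟪u, v⟫_ℂ).re := by rw [e4, Complex.conj_re]
  have i4 : (⟪v, u⟫_ℂ).im = -(⟪u, v⟫_ℂ).im := by rw [e4, Complex.conj_im]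
  simp only [inner_add_left, inner_add_right]
  apply Complex.ext
  · simp [r4]
    ring
  · simp [i4]
    ring

theorem weyl_zero : weyl (0 : K) = 1 :=
  clm_ext_expVec fun w => by simp [weyl_expVec]

theorem inner_weyl (u : K) (x y : Fock K) : ⟪weyl u x, weyl u y⟫_ℂ = ⟪x, y⟫_ℂ := by
  have h : ∀ x : Fock K, ‖weyl u x‖ = ‖x‖ := by
    have h1 : (fun x : Fock K => ‖weyl u x‖) ∘ expComb K = (fun x => ‖x‖) ∘ expComb K := by
      funext x
      have h2 := LinearMap.extendOfNorm_eq (f := Finsupp.linearCombination ℂ (weylVec u))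
        denseRange_expComb ⟨1, fun x => by rw [one_mul, norm_linearCombination_weylVec]⟩ x
      simp only [Function.comp_apply, weyl, h2, norm_linearCombination_weylVec]
    intro x
    exact congrFun (denseRange_expComb.equalizer (weyl u).continuous.norm continuous_norm h1) x
  exact LinearIsometry.inner_map_map ⟨(weyl u).toLinearMap, h⟩ x y

theorem weyl_mem_unitary (u : K) : weyl u ∈ unitary (Fock K →L[ℂ] Fock K) := by
  have h1 : star (weyl u) * weyl u = 1 := by
    ext1 x
    refine ext_inner_right ℂ fun y => ?_
    rw [mul_apply_eq_comp, ContinuousLinearMap.star_eq_adjoint,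
      ContinuousLinearMap.adjoint_inner_left, inner_weyl]
    rfl
  have h2 : weyl u * weyl (-u) = 1 := by
    rw [weyl_mul]
    have h0 : (⟪u, u⟫_ℂ).im = 0 := inner_self_im (𝕜 := ℂ) u
    rw [inner_neg_right, Complex.neg_im, h0, add_neg_cancel, weyl_zero]
    simp
  have h3 : star (weyl u) = weyl (-u) := left_inv_eq_right_inv h1 h2
  exact Unitary.mem_iff.2 ⟨h1, by rw [h3]; exact h2⟩

section Semigroups

variable {H : Type*} [NormedAddCommGroup H] [InnerProductSpace ℂ H] [CompleteSpace H]

/-- A functional on `B(H)` belongs to the predual `B(H)_*` (the trace class operators acting by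
the trace) if it is of the form `T ↦ ∑ₙ ⟪ξₙ, T ηₙ⟫` with square summable sequences `ξ`, `η`
in `H`. -/
def IsNormalFunctional (ρ : (H →L[ℂ] H) →ₗ[ℂ] ℂ) : Prop :=
  ∃ ξ η : lp (fun _ : ℕ => H) 2, ∀ T : H →L[ℂ] H, ρ T = ∑' n, ⟪ξ n, T (η n)⟫_ℂ

variable (H) in
/-- The σ-weak topology on `B(H)`: the weak topology given by the predual. -/
abbrev sigmaWeak : TopologicalSpace (H →L[ℂ] H) :=
  ⨅ ρ : {ρ : (H →L[ℂ] H) →ₗ[ℂ] ℂ // IsNormalFunctional ρ}, TopologicalSpace.induced ρ.1 inferInstance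

/-- A `*`-endomorphism of `B(H)`, not assumed unital, is normal if it is σ-weakly continuous. -/
def IsNormalEndo (φ : (H →L[ℂ] H) →⋆ₙₐ[ℂ] (H →L[ℂ] H)) : Prop :=
  @Continuous _ _ (sigmaWeak H) (sigmaWeak H) φ

/-- An E-semigroup on `B(H)` over a closed convex cone `P`: a semigroup of normal
`*`-endomorphisms of `B(H)` indexed by `P`, continuous against the predual. -/
structure IsESemigroup {d : ℕ} (P : ProperCone ℝ (EuclideanSpace ℝ (Fin d)))
    (α : P → (H →L[ℂ] H) →⋆ₙₐ[ℂ] (H →L[ℂ] H)) : Prop where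
  normal : ∀ x, IsNormalEndo (α x)
  map_zero : ∀ T, α 0 T = T
  map_add : ∀ x y T, α (x + y) T = α x (α y T)
  continuous : ∀ ρ : (H →L[ℂ] H) →ₗ[ℂ] ℂ, IsNormalFunctional ρ → ∀ T, Continuous fun x => ρ (α x T)

/-- An E₀-semigroup is a unital E-semigroup. -/
structure IsE0Semigroup {d : ℕ} (P : ProperCone ℝ (EuclideanSpace ℝ (Fin d)))
    (α : P → (H →L[ℂ] H) →⋆ₙₐ[ℂ] (H →L[ℂ] H)) : Prop extends IsESemigroup P α where
  unital : ∀ x, α x 1 = 1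

/-- A strongly continuous representation of the cone `P` by isometries. -/
structure IsIsometricRep {d : ℕ} (P : ProperCone ℝ (EuclideanSpace ℝ (Fin d)))
    (V : P → H →L[ℂ] H) : Prop where
  isometry : ∀ x, Isometry (V x)
  map_add : ∀ x y, V (x + y) = V x ∘L V y
  continuous : ∀ ξ, Continuous fun x => V x ξ

end Semigroups

end CCR

end

/-!
Splitting `L = ran V ⊕ (ran V)ᗮ` for an isometry `V : K → L` gives a unitary
`Γ(L) ≅ Γ(K) ⊗ Γ((ran V)ᗮ)` under which `e(V k + m)` becomes `e(k) ⊗ e(m)` and `W(V u)` becomes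
`W(u) ⊗ 1`. Hence `T ↦ T ⊗ 1` is a normal unital endomorphism sending `W(u)` to `W(V u)`. The Weyl
operators act irreducibly, because an operator commuting with all of them has a matrix coefficient
between exponential vectors that is both holomorphic and antiholomorphic, hence constant. By the
bicommutant theorem, in the form that approximates along square summable sequences of vectors, a
normal functional is determined by its values on them. This gives uniqueness, and the semigroup law
follows from it. Continuity reduces, by boundedness and density, to matrix coefficients between
exponential vectors, which depend on `x` only through the vectors `V x* u`. These vary continuously:
`‖V (x + h)* u - V x* u‖ ≤ ‖V h u - u‖`, and for `y` in the cone near `x` there are `a` and `b` in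
the cone near `0` with `x + a = y + b`.
-/

noncomputable section

namespace CCR

open scoped InnerProductSpace lp ENNReal

section Amplification

variable {𝕜 H : Type*} [RCLike 𝕜] [NormedAddCommGroup H] [InnerProductSpace 𝕜 H] (ι : Type*)

/-- The amplification of an operator `T` on `H` to `ℓ²(ι, H)`, acting as `T` on every coordinate. -/
def amp (T : H →L[𝕜] H) : ℓ²(ι, H) →L[𝕜] ℓ²(ι, H) :=
  lp.mapCLM 2 (fun _ => T) (norm_nonneg T) fun _ => le_rfl

variable {ι}

@[simp]
theorem amp_apply (T : H →L[𝕜] H) (ξ : ℓ²(ι, H)) (i : ι) : amp ι T ξ i = T (ξ i) :=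
  rfl

theorem amp_single [DecidableEq ι] (T : H →L[𝕜] H) (i : ι) (x : H) :
    amp ι T (lp.single 2 i x) = lp.single 2 i (T x) := by
  ext j
  rcases eq_or_ne j i with rfl | hj <;> simp [*]

/-- The functional `T ↦ ∑ᵢ ⟪ξᵢ, T ηᵢ⟫` on `B(H)` given by two vectors of `ℓ²(ι, H)`: a matrix
coefficient of the amplification. -/
def ampFunctional (ξ η : ℓ²(ι, H)) : (H →L[𝕜] H) →ₗ[𝕜] 𝕜 where
  toFun T := ⟪ξ, amp ι T η⟫_𝕜
  map_add' S T := by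
    rw [← inner_add_right]
    rfl
  map_smul' c T := by
    rw [RingHom.id_apply, smul_eq_mul, ← inner_smul_right]
    rfl

theorem ampFunctional_apply (ξ η : ℓ²(ι, H)) (T : H →L[𝕜] H) :
    ampFunctional ξ η T = ⟪ξ, amp ι T η⟫_𝕜 :=
  rfl

theorem hasSum_ampFunctional (ξ η : ℓ²(ι, H)) (T : H →L[𝕜] H) :
    HasSum (fun i => ⟪ξ i, T (η i)⟫_𝕜) (ampFunctional ξ η T) :=
  lp.hasSum_inner ξ (amp ι T η)

variable [CompleteSpace H]

variable (𝕜 H ι) in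
/-- Amplification to `ℓ²(ι, H)`, as a unital `*`-homomorphism. -/
def ampHom : (H →L[𝕜] H) →⋆ₐ[𝕜] (ℓ²(ι, H) →L[𝕜] ℓ²(ι, H)) where
  toFun := amp ι
  map_one' := by ext; simp
  map_mul' S T := by ext; simp
  map_zero' := by ext; simp
  map_add' S T := by ext; simp
  commutes' c := by ext; simp [Algebra.algebraMap_eq_smul_one]
  map_star' T := by
    rw [ContinuousLinearMap.star_eq_adjoint, ContinuousLinearMap.star_eq_adjoint,
      ContinuousLinearMap.eq_adjoint_iff]
    intro ξ η
    rw [lp.inner_eq_tsum, lp.inner_eq_tsum]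
    exact tsum_congr fun i => ContinuousLinearMap.adjoint_inner_left _ _ _

end Amplification

section GramKernel

variable {𝕜 α E F : Type*} [RCLike 𝕜] [NormedAddCommGroup E] [InnerProductSpace 𝕜 E]
  [NormedAddCommGroup F] [InnerProductSpace 𝕜 F] {f : α → E} {g : α → F}

theorem norm_linearCombination_eq_of_inner_eq (h : ∀ a b, ⟪f a, f b⟫_𝕜 = ⟪g a, g b⟫_𝕜)
    (x : α →₀ 𝕜) :
    ‖Finsupp.linearCombination 𝕜 f x‖ = ‖Finsupp.linearCombination 𝕜 g x‖ := by
  simp only [norm_eq_sqrt_re_inner (𝕜 := 𝕜), Finsupp.linearCombination_apply, Finsupp.sum,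
    sum_inner, inner_sum, inner_smul_left, inner_smul_right, h]

variable [CompleteSpace E]

theorem denseRange_linearCombination_of_orthogonal_eq_zero
    (hf : ∀ ξ : E, (∀ a, ⟪ξ, f a⟫_𝕜 = 0) → ξ = 0) :
    DenseRange (Finsupp.linearCombination 𝕜 f) := by
  rw [DenseRange, ← LinearMap.coe_range, Submodule.dense_iff_topologicalClosure_eq_top,
    Submodule.topologicalClosure_eq_top_iff, Submodule.eq_bot_iff]
  refine fun ξ hξ => hf ξ fun a => Submodule.inner_left_of_mem_orthogonal ?_ hξ
  exact ⟨Finsupp.single a 1, by simp⟩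

theorem exists_linearIsometryEquiv_of_inner_eq [CompleteSpace F]
    (hf : DenseRange (Finsupp.linearCombination 𝕜 f))
    (hg : DenseRange (Finsupp.linearCombination 𝕜 g))
    (h : ∀ a b, ⟪f a, f b⟫_𝕜 = ⟪g a, g b⟫_𝕜) :
    ∃ U : E ≃ₗᵢ[𝕜] F, ∀ a, U (f a) = g a :=
  ⟨(LinearEquiv.refl 𝕜 (α →₀ 𝕜)).extendOfIsometry _ _ hf hg
      fun x => (norm_linearCombination_eq_of_inner_eq h x).symm, fun a => by
    simpa using LinearEquiv.extendOfIsometry_eq (LinearEquiv.refl 𝕜 (α →₀ 𝕜)) _ _ hf hg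
      (fun x => (norm_linearCombination_eq_of_inner_eq h x).symm) (Finsupp.single a 1)⟩

end GramKernel

section TensorVec

variable {𝕜 ι E H : Type*} [RCLike 𝕜] [NormedAddCommGroup E] [InnerProductSpace 𝕜 E]
  [NormedAddCommGroup H] [InnerProductSpace 𝕜 H] (b : HilbertBasis ι 𝕜 E)

/-- The elementary tensor `x ⊗ y` in the Hilbert space tensor product of `E` and `H`, which a
Hilbert basis `b` of `E` identifies with `ℓ²(ι, H)`. -/
def tensorVec (x : E) (y : H) : ℓ²(ι, H) :=
  lp.mapCLM 2 (fun _ : ι => (ContinuousLinearMap.id 𝕜 𝕜).smulRight y) (norm_nonneg y)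
    (fun _ => by simp [ContinuousLinearMap.norm_smulRight_apply]) (b.repr x)

@[simp]
theorem tensorVec_apply (x : E) (y : H) (i : ι) : tensorVec b x y i = ⟪b i, x⟫_𝕜 • y := by
  simp [tensorVec, b.repr_apply_apply]

theorem tensorVec_smul (c : 𝕜) (x : E) (y : H) : tensorVec b x (c • y) = c • tensorVec b x y := by
  ext i
  simp [smul_comm c]

theorem amp_tensorVec (T : H →L[𝕜] H) (x : E) (y : H) :
    amp ι T (tensorVec b x y) = tensorVec b x (T y) := by
  ext i
  simp

theorem inner_tensorVec (x x' : E) (y y' : H) :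
    ⟪tensorVec b x y, tensorVec b x' y'⟫_𝕜 = ⟪x, x'⟫_𝕜 * ⟪y, y'⟫_𝕜 := by
  rw [lp.inner_eq_tsum, ← b.tsum_inner_mul_inner, ← tsum_mul_right]
  refine tsum_congr fun i => ?_
  rw [tensorVec_apply, tensorVec_apply, inner_smul_left, inner_smul_right, inner_conj_symm]
  ring

theorem eq_zero_of_inner_tensorVec {α β : Type*} {f : α → E} {g : β → H}
    (hf : ∀ x : E, (∀ a, ⟪x, f a⟫_𝕜 = 0) → x = 0) (hg : ∀ y : H, (∀ c, ⟪y, g c⟫_𝕜 = 0) → y = 0)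
    (ξ : ℓ²(ι, H)) (h : ∀ a c, ⟪ξ, tensorVec b (f a) (g c)⟫_𝕜 = 0) : ξ = 0 := by
  -- For fixed `y`, contracting `ξ` against `y` gives the vector of `E` with coordinates `⟪y, ξ i⟫`.
  let contract (y : H) : E := b.repr.symm
    (lp.mapCLM 2 (fun _ : ι => innerSL 𝕜 y) (norm_nonneg _) (fun _ => le_rfl) ξ)
  have inner_contract (y : H) (x : E) : ⟪contract y, x⟫_𝕜 = ⟪ξ, tensorVec b x y⟫_𝕜 := by
    rw [← b.repr.inner_map_map, LinearIsometryEquiv.apply_symm_apply, lp.inner_eq_tsum,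
      lp.inner_eq_tsum]
    refine tsum_congr fun i => ?_
    simp [inner_smul_right, b.repr_apply_apply, RCLike.inner_apply]
  ext1
  funext i
  refine hg _ fun c => ?_
  have contract_eq_zero : contract (g c) = 0 := hf _ fun a => by rw [inner_contract, h]
  have inner_eq : ⟪b i, contract (g c)⟫_𝕜 = ⟪g c, ξ i⟫_𝕜 := by
    simp [contract, ← b.repr_apply_apply]
  rw [inner_eq_zero_symm, ← inner_eq, contract_eq_zero, inner_zero_right]

end TensorVec

section ExponentialLaw

variable {K L N : Type*} [NormedAddCommGroup K] [InnerProductSpace ℂ K] [NormedAddCommGroup L]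
  [InnerProductSpace ℂ L] [NormedAddCommGroup N] [InnerProductSpace ℂ N]

theorem exists_fock_linearIsometryEquiv_tensorVec {ι : Type*} (b : HilbertBasis ι ℂ (Fock N))
    (D : L ≃ₗᵢ[ℂ] WithLp 2 (K × N)) :
    ∃ U : Fock L ≃ₗᵢ[ℂ] ℓ²(ι, Fock K),
      ∀ u, U (expVec u) = tensorVec b (expVec (D u).snd) (expVec (D u).fst) := by
  refine exists_linearIsometryEquiv_of_inner_eq denseRange_expComb
    (denseRange_linearCombination_of_orthogonal_eq_zero fun ξ hξ => ?_) fun u v => ?_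
  · refine eq_zero_of_inner_tensorVec b eq_zero_of_inner_expVec eq_zero_of_inner_expVec ξ
      fun w u => ?_
    simpa using hξ (D.symm (WithLp.toLp 2 (u, w)))
  · rw [inner_tensorVec, inner_expVec, inner_expVec, inner_expVec, ← D.inner_map_map,
      WithLp.prod_inner_apply, Complex.exp_add, mul_comm]
    rfl

end ExponentialLaw

section Irreducibility

theorem eq_of_differentiable_of_differentiable_conj {f : ℂ → ℂ} (hf : Differentiable ℂ f)
    (hf' : Differentiable ℂ fun z => starRingEnd ℂ (f z)) (z w : ℂ) : f z = f w := by
  obtain ⟨a, ha⟩ := (Complex.analyticOnNhd_univ_iff_differentiable.2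
    (hf.fun_add hf')).eq_const_of_im_eq_const (c₀ := 0) (by simp) isOpen_univ isConnected_univ
  obtain ⟨b, hb⟩ := (Complex.analyticOnNhd_univ_iff_differentiable.2
    (hf.fun_sub hf')).eq_const_of_re_eq_const (c₀ := 0) (by simp) isOpen_univ isConnected_univ
  linear_combination (ha z trivial - ha w trivial + hb z trivial - hb w trivial) / 2

theorem differentiable_of_hasSum_pow_smul {E : Type*} [NormedAddCommGroup E] [NormedSpace ℂ E]
    [CompleteSpace E] {f : ℂ → E} {a : ℕ → E} (h : ∀ z, HasSum (fun n => z ^ n • a n) (f z)) :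
    Differentiable ℂ f := by
  let p : FormalMultilinearSeries ℂ ℂ E := fun n =>
    ContinuousMultilinearMap.mkPiRing ℂ (Fin n) (a n)
  have hp : HasFPowerSeriesOnBall f p 0 ⊤ :=
    { r_le := by
        refine (ENNReal.eq_top_of_forall_nnreal_le fun r => p.le_radius_of_tendsto (l := 0) ?_).ge
        simpa [p, norm_smul, mul_comm] using (h r).summable.tendsto_atTop_zero.norm
      r_pos := ENNReal.zero_lt_top
      hasSum := fun {z} _ => by simpa [p] using h z }
  rw [← Complex.analyticOnNhd_univ_iff_differentiable]
  simpa using hp.analyticOnNhd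

variable {K : Type*} [NormedAddCommGroup K] [InnerProductSpace ℂ K]

theorem hasSum_inner_expVec_smul (ξ : Fock K) (u : K) (z : ℂ) :
    HasSum (fun n => z ^ n • ((√n.factorial : ℂ)⁻¹ * ⟪ξ n, tpow n u⟫_ℂ)) ⟪ξ, expVec (z • u)⟫_ℂ := by
  refine (lp.hasSum_inner (𝕜 := ℂ) ξ (expVec (z • u))).congr_fun fun n => ?_
  rw [expVec_apply, inner_smul_right, tpow_smul, inner_smul_right, smul_eq_mul]
  ring

theorem inner_expVec_eq_of_conj {ξ η : Fock K}
    (h : ∀ u, starRingEnd ℂ ⟪ξ, expVec u⟫_ℂ = ⟪η, expVec (-u)⟫_ℂ) (u : K) :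
    ⟪ξ, expVec u⟫_ℂ = ⟪ξ, expVec 0⟫_ℂ := by
  have entire (ζ : Fock K) (v : K) : Differentiable ℂ fun z : ℂ => ⟪ζ, expVec (z • v)⟫_ℂ :=
    differentiable_of_hasSum_pow_smul (hasSum_inner_expVec_smul ζ v)
  have entire_conj : Differentiable ℂ fun z : ℂ => starRingEnd ℂ ⟪ξ, expVec (z • u)⟫_ℂ := by
    simpa only [h, ← smul_neg] using entire η (-u)
  simpa using eq_of_differentiable_of_differentiable_conj (entire ξ u) entire_conj 1 0

theorem star_weyl (u : K) : star (weyl u) = weyl (-u) := by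
  refine left_inv_eq_right_inv (Unitary.mem_iff.1 (weyl_mem_unitary u)).1 ?_
  have him : (⟪u, u⟫_ℂ).im = 0 := inner_self_im (𝕜 := ℂ) u
  rw [weyl_mul, inner_neg_right, Complex.neg_im, him, add_neg_cancel, weyl_zero]
  simp

theorem expVec_eq_smul_weyl (u : K) :
    expVec u = Complex.exp ((‖u‖ : ℂ) ^ 2 / 2) • weyl u (expVec 0) := by
  rw [weyl_expVec, smul_smul, ← Complex.exp_add]
  simp [neg_div]

theorem exists_eq_smul_one_of_commute_weyl {B : Fock K →L[ℂ] Fock K}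
    (hB : ∀ u : K, Commute (weyl u) B) : ∃ c : ℂ, B = c • 1 := by
  have hcomm (u : K) (ξ : Fock K) : B (weyl u ξ) = weyl u (B ξ) :=
    (DFunLike.congr_fun (hB u).eq ξ).symm
  have hconj (u : K) :
      starRingEnd ℂ ⟪B (expVec 0), expVec u⟫_ℂ = ⟪B.adjoint (expVec 0), expVec (-u)⟫_ℂ := by
    rw [inner_conj_symm, ContinuousLinearMap.adjoint_inner_left, expVec_eq_smul_weyl (-u),
      expVec_eq_smul_weyl u, map_smul, hcomm, inner_smul_right, inner_smul_left, ← star_weyl,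
      ContinuousLinearMap.star_eq_adjoint, ContinuousLinearMap.adjoint_inner_right, norm_neg,
      ← Complex.exp_conj, map_div₀, map_pow, Complex.conj_ofReal, map_ofNat]
  obtain ⟨c, hvacuum⟩ : ∃ c : ℂ, B (expVec 0) = c • expVec 0 := by
    refine ⟨⟪expVec 0, B (expVec 0)⟫_ℂ, sub_eq_zero.1 (eq_zero_of_inner_expVec _ fun u => ?_)⟩
    rw [inner_sub_left, inner_expVec_eq_of_conj hconj, inner_smul_left, inner_conj_symm,
      inner_expVec, inner_zero_left, Complex.exp_zero, mul_one, sub_self]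
  refine ⟨c, clm_ext_expVec fun v => ?_⟩
  rw [expVec_eq_smul_weyl v, map_smul, hcomm, hvacuum]
  simp

end Irreducibility

section Bicommutant

variable {𝕜 H : Type*} [RCLike 𝕜] [NormedAddCommGroup H] [InnerProductSpace 𝕜 H]

theorem amp_mem_centralizer_centralizer (ι : Type*) {S : Set (H →L[𝕜] H)} {T : H →L[𝕜] H}
    (hT : T ∈ S.centralizer.centralizer) :
    amp ι T ∈ (amp ι '' S).centralizer.centralizer := by
  classical
  intro Q hQ
  -- The matrix entries of `Q` commute with `S`, hence with `T`.
  let entry (i j : ι) : H →L[𝕜] H := lp.evalCLM 𝕜 (fun _ : ι => H) 2 i ∘L Q ∘L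
    lp.singleContinuousLinearMap 𝕜 (fun _ : ι => H) 2 j
  have entry_apply (i j : ι) (x : H) : entry i j x = Q (lp.single 2 j x) i := rfl
  have entry_mem (i j : ι) : entry i j ∈ S.centralizer := fun A hA => by
    ext x
    have hQA := DFunLike.congr_fun (hQ _ ⟨A, hA, rfl⟩) (lp.single 2 j x)
    simp only [mul_apply_eq_comp, amp_single] at hQA
    simp only [mul_apply_eq_comp, entry_apply, ← hQA, amp_apply]
  have hsingle (j : ι) (x : H) :
      (Q * amp ι T) (lp.single 2 j x) = (amp ι T * Q) (lp.single 2 j x) := by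
    ext i
    simpa [amp_single, entry_apply] using DFunLike.congr_fun (hT _ (entry_mem i j)) x
  ext1 ξ
  have hξ := lp.hasSum_single (p := 2) (by norm_num) ξ
  exact (hξ.mapL (Q * amp ι T)).unique
    ((hξ.mapL (amp ι T * Q)).congr_fun fun j => hsingle j (ξ j))

variable [CompleteSpace H]

theorem commute_starProjection_of_mem_invtSubmodule {A : H →L[𝕜] H} {N : Submodule 𝕜 H}
    [N.HasOrthogonalProjection] (hA : N ∈ Module.End.invtSubmodule A.toLinearMap)
    (hA' : N ∈ Module.End.invtSubmodule A.adjoint.toLinearMap) :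
    Commute N.starProjection A :=
  (ContinuousLinearMap.IsIdempotentElem.commute_iff N.isIdempotentElem_starProjection).2
    (by simpa using ⟨hA, A.orthogonal_mem_invtSubmodule hA'⟩)

theorem mem_invtSubmodule_of_mem_centralizer_centralizer {S : Set (H →L[𝕜] H)}
    (hS : ∀ A ∈ S, A.adjoint ∈ S) {N : Submodule 𝕜 H} [N.HasOrthogonalProjection]
    (hN : ∀ A ∈ S, N ∈ Module.End.invtSubmodule A.toLinearMap) {T : H →L[𝕜] H}
    (hT : T ∈ S.centralizer.centralizer) : N ∈ Module.End.invtSubmodule T.toLinearMap := by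
  have proj_mem : N.starProjection ∈ S.centralizer := fun A hA =>
    (commute_starProjection_of_mem_invtSubmodule (hN A hA) (hN _ (hS A hA))).symm
  have hTcomm : Commute N.starProjection T := hT _ proj_mem
  simpa using ((ContinuousLinearMap.IsIdempotentElem.commute_iff
    N.isIdempotentElem_starProjection).1 hTcomm).1

theorem apply_mem_closure_of_mem_centralizer_centralizer (S : StarSubalgebra 𝕜 (H →L[𝕜] H))
    {T : H →L[𝕜] H} (hT : T ∈ (S : Set (H →L[𝕜] H)).centralizer.centralizer) (η : H) :
    T η ∈ (S.toSubalgebra.toSubmodule.map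
      (ContinuousLinearMap.apply 𝕜 H η).toLinearMap).topologicalClosure := by
  have apply_mem {A : H →L[𝕜] H} (hA : A ∈ S) : A η ∈ S.toSubalgebra.toSubmodule.map
      (ContinuousLinearMap.apply 𝕜 H η).toLinearMap := ⟨A, hA, rfl⟩
  refine mem_invtSubmodule_of_mem_centralizer_centralizer (fun A hA => star_mem hA)
    (fun A hA => ?_) hT (Submodule.le_topologicalClosure _ (apply_mem (one_mem S)))
  refine Set.MapsTo.closure ?_ A.continuous
  rintro _ ⟨B, hB, rfl⟩
  exact apply_mem (mul_mem hA hB)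

theorem ampFunctional_eq_zero_of_mem_centralizer_centralizer {ι : Type*}
    (S : StarSubalgebra 𝕜 (H →L[𝕜] H)) {ξ η : ℓ²(ι, H)}
    (h : S.toSubalgebra.toSubmodule ≤ (ampFunctional ξ η).ker) {T : H →L[𝕜] H}
    (hT : T ∈ (S : Set (H →L[𝕜] H)).centralizer.centralizer) :
    ampFunctional ξ η T = 0 := by
  have hclosure := apply_mem_closure_of_mem_centralizer_centralizer (S.map (ampHom 𝕜 H ι))
    (amp_mem_centralizer_centralizer ι hT) η
  rw [← Submodule.orthogonal_orthogonal_eq_closure] at hclosure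
  refine Submodule.inner_right_of_mem_orthogonal ?_ hclosure
  rw [Submodule.mem_orthogonal']
  rintro _ ⟨_, ⟨A, hA, rfl⟩, rfl⟩
  exact h hA

end Bicommutant

section WeylAlgebra

variable {K : Type*} [NormedAddCommGroup K] [InnerProductSpace ℂ K]

variable (K) in
/-- The `*`-algebra generated by the Weyl operators. By the Weyl relations it is their linear
span. -/
def weylAlgebra : StarSubalgebra ℂ (Fock K →L[ℂ] Fock K) where
  __ := (Submodule.span ℂ (Set.range (weyl (K := K)))).toSubalgebra
    (Submodule.subset_span ⟨0, weyl_zero⟩) fun S T hS hT => by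
      have hST := Submodule.mul_mem_mul hS hT
      rw [Submodule.span_mul_span] at hST
      refine Submodule.span_le.2 ?_ hST
      rintro _ ⟨_, ⟨u, rfl⟩, _, ⟨v, rfl⟩, rfl⟩
      beta_reduce
      rw [weyl_mul]
      exact Submodule.smul_mem _ _ (Submodule.subset_span ⟨u + v, rfl⟩)
  star_mem' {T} hT := by
    induction hT using Submodule.span_induction with
    | mem T hT =>
      obtain ⟨u, rfl⟩ := hT
      exact Submodule.subset_span ⟨-u, (star_weyl u).symm⟩
    | zero => simp
    | add S T _ _ hS hT => simpa using add_mem hS hT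
    | smul c T _ hT => simpa using Submodule.smul_mem _ (star c) hT

theorem weyl_mem_weylAlgebra (u : K) : weyl u ∈ weylAlgebra K :=
  Submodule.subset_span ⟨u, rfl⟩

theorem mem_centralizer_centralizer_weylAlgebra (T : Fock K →L[ℂ] Fock K) :
    T ∈ (weylAlgebra K : Set (Fock K →L[ℂ] Fock K)).centralizer.centralizer := by
  intro B hB
  obtain ⟨c, rfl⟩ := exists_eq_smul_one_of_commute_weyl fun u => hB _ (weyl_mem_weylAlgebra u)
  simp

theorem ampFunctional_eq_zero_of_weyl {ι : Type*} {ξ η : ℓ²(ι, Fock K)}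
    (h : ∀ u : K, ampFunctional (𝕜 := ℂ) ξ η (weyl u) = 0) : ampFunctional (𝕜 := ℂ) ξ η = 0 := by
  have hS : Submodule.span ℂ (Set.range weyl) ≤ (ampFunctional ξ η).ker :=
    Submodule.span_le.2 (Set.range_subset_iff.2 h)
  ext T
  exact ampFunctional_eq_zero_of_mem_centralizer_centralizer (weylAlgebra K) hS
    (mem_centralizer_centralizer_weylAlgebra T)

end WeylAlgebra

section NormalFunctional

theorem memℓp_two_iff {ι : Type*} {E : ι → Type*} [∀ i, NormedAddCommGroup (E i)]
    {f : ∀ i, E i} : Memℓp f 2 ↔ Summable fun i => ‖f i‖ ^ 2 := by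
  rw [memℓp_gen_iff (by norm_num)]
  simp

theorem summable_norm_sq {ι : Type*} {E : ι → Type*} [∀ i, NormedAddCommGroup (E i)]
    (f : lp E 2) : Summable fun i => ‖f i‖ ^ 2 :=
  memℓp_two_iff.1 (lp.memℓp f)

variable {H : Type*} [NormedAddCommGroup H] [InnerProductSpace ℂ H]

theorem isNormalFunctional_ampFunctional {ι : Type*} (ξ η : ℓ²(ι, H)) :
    IsNormalFunctional (ampFunctional (𝕜 := ℂ) ξ η) := by
  let s : Set ι := Function.support fun i => ‖ξ i‖ ^ 2
  obtain ⟨f, hf⟩ : ∃ f : s → ℕ, f.Injective :=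
    Set.countable_iff_exists_injective.1 (summable_norm_sq ξ).countable_support
  let reindex (ζ : ι → H) : ℕ → H := Function.extend f (fun i => ζ i) 0
  have reindex_apply (ζ : ι → H) (i : s) : reindex ζ (f i) = ζ i := hf.extend_apply _ _ _
  have reindex_eq_zero (ζ : ι → H) {n : ℕ} (hn : n ∉ Set.range f) : reindex ζ n = 0 :=
    Function.extend_apply' _ _ _ (by simpa using hn)
  have reindex_mem (ζ : ℓ²(ι, H)) : Memℓp (reindex ζ) 2 := by
    rw [memℓp_two_iff, ← hf.summable_iff fun n hn => by simp [reindex_eq_zero ζ hn]]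
    exact ((summable_norm_sq ζ).subtype s).congr fun i => by simp [reindex_apply]
  refine ⟨⟨_, reindex_mem ξ⟩, ⟨_, reindex_mem η⟩, fun T => (HasSum.tsum_eq ?_).symm⟩
  have hsupport : (Function.support fun i => ⟪ξ i, T (η i)⟫_ℂ) ⊆ s :=
    Function.support_subset_iff'.2 fun i hi => by
      have : ξ i = 0 := by simpa [s] using hi
      simp [this]
  rw [← hf.hasSum_iff fun n hn => by simp [reindex_eq_zero _ hn]]
  simpa only [Function.comp_def, reindex_apply] using
    (hasSum_subtype_iff_of_support_subset hsupport).2 (hasSum_ampFunctional ξ η T)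

theorem isNormalFunctional_iff {ρ : (H →L[ℂ] H) →ₗ[ℂ] ℂ} :
    IsNormalFunctional ρ ↔ ∃ ξ η : ℓ²(ℕ, H), ρ = ampFunctional ξ η :=
  exists_congr fun ξ => exists_congr fun η => by
    simp only [LinearMap.ext_iff, (hasSum_ampFunctional ξ η _).tsum_eq]

theorem isNormalFunctional_zero : IsNormalFunctional (0 : (H →L[ℂ] H) →ₗ[ℂ] ℂ) :=
  ⟨0, 0, fun T => by simp⟩

theorem IsNormalFunctional.smul {ρ : (H →L[ℂ] H) →ₗ[ℂ] ℂ} (hρ : IsNormalFunctional ρ) (c : ℂ) :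
    IsNormalFunctional (c • ρ) := by
  obtain ⟨ξ, η, hρ⟩ := hρ
  exact ⟨ξ, c • η, fun T => by simp [hρ, tsum_mul_left]⟩

theorem IsNormalFunctional.add {ρ σ : (H →L[ℂ] H) →ₗ[ℂ] ℂ} (hρ : IsNormalFunctional ρ)
    (hσ : IsNormalFunctional σ) : IsNormalFunctional (ρ + σ) := by
  obtain ⟨ξ, η, rfl⟩ := isNormalFunctional_iff.1 hρ
  obtain ⟨ξ', η', rfl⟩ := isNormalFunctional_iff.1 hσ
  have elim_mem (ζ ζ' : ℓ²(ℕ, H)) : Memℓp (Sum.elim ζ ζ' : ℕ ⊕ ℕ → H) 2 :=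
    memℓp_two_iff.2 (Summable.sum _ (summable_norm_sq ζ) (summable_norm_sq ζ'))
  have hadd : ampFunctional ξ η + ampFunctional ξ' η' =
      ampFunctional (𝕜 := ℂ) (ι := ℕ ⊕ ℕ) ⟨_, elim_mem ξ ξ'⟩ ⟨_, elim_mem η η'⟩ :=
    LinearMap.ext fun T => by
      refine HasSum.unique ?_ (hasSum_ampFunctional _ _ T)
      exact HasSum.sum (hasSum_ampFunctional ξ η T) (hasSum_ampFunctional ξ' η' T)
  rw [hadd]
  exact isNormalFunctional_ampFunctional _ _

theorem isNormalFunctional_iff_continuous {ρ : (H →L[ℂ] H) →ₗ[ℂ] ℂ} :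
    IsNormalFunctional ρ ↔ @Continuous _ _ (sigmaWeak H) _ ρ := by
  refine ⟨fun hρ => continuous_iInf_dom (i := ⟨ρ, hρ⟩) continuous_induced_dom, fun hρ => ?_⟩
  have hspan := (LinearMap.mem_span_iff_continuous
    (f := fun ρ : {ρ : (H →L[ℂ] H) →ₗ[ℂ] ℂ // IsNormalFunctional ρ} => ρ.1) ρ).2 hρ
  clear hρ
  induction hspan using Submodule.span_induction with
  | mem ρ h =>
    obtain ⟨ρ, rfl⟩ := h
    exact ρ.2
  | zero => exact isNormalFunctional_zero
  | add ρ σ _ _ hρ hσ => exact hρ.add hσ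
  | smul c ρ _ hρ => exact hρ.smul c

variable [CompleteSpace H]

theorem isNormalEndo_iff {φ : (H →L[ℂ] H) →⋆ₙₐ[ℂ] (H →L[ℂ] H)} :
    IsNormalEndo φ ↔
      ∀ ρ, IsNormalFunctional ρ →
        IsNormalFunctional (ρ ∘ₗ (φ : (H →L[ℂ] H) →ₗ[ℂ] (H →L[ℂ] H))) := by
  simp only [IsNormalEndo, continuous_iInf_rng, continuous_induced_rng, Subtype.forall,
    isNormalFunctional_iff_continuous, LinearMap.coe_comp, LinearMap.coe_coe]

theorem IsNormalEndo.comp {φ ψ : (H →L[ℂ] H) →⋆ₙₐ[ℂ] (H →L[ℂ] H)} (hφ : IsNormalEndo φ)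
    (hψ : IsNormalEndo ψ) : IsNormalEndo (φ.comp ψ) :=
  @Continuous.comp _ _ _ (sigmaWeak H) (sigmaWeak H) (sigmaWeak H) ψ φ hφ hψ

variable (H) in
theorem isNormalEndo_id : IsNormalEndo (NonUnitalStarAlgHom.id ℂ (H →L[ℂ] H)) :=
  @continuous_id _ (sigmaWeak H)

end NormalFunctional

section WeylUniqueness

variable {K : Type*} [NormedAddCommGroup K] [InnerProductSpace ℂ K]

theorem IsNormalFunctional.ext_weyl {ρ σ : (Fock K →L[ℂ] Fock K) →ₗ[ℂ] ℂ}
    (hρ : IsNormalFunctional ρ) (hσ : IsNormalFunctional σ) (h : ∀ u, ρ (weyl u) = σ (weyl u)) :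
    ρ = σ := by
  obtain ⟨ξ, η, hξη⟩ := isNormalFunctional_iff.1 (hρ.add (hσ.smul (-1)))
  have hzero : ρ + (-1 : ℂ) • σ = 0 := hξη.trans <| ampFunctional_eq_zero_of_weyl fun u => by
    simp [← hξη, h]
  rwa [neg_one_smul, ← sub_eq_add_neg, sub_eq_zero] at hzero

theorem IsNormalEndo.ext_weyl {φ ψ : (Fock K →L[ℂ] Fock K) →⋆ₙₐ[ℂ] (Fock K →L[ℂ] Fock K)}
    (hφ : IsNormalEndo φ) (hψ : IsNormalEndo ψ) (h : ∀ u, φ (weyl u) = ψ (weyl u)) : φ = ψ := by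
  ext1 T
  ext1 η
  refine ext_inner_left ℂ fun ξ => ?_
  have hρ := isNormalFunctional_ampFunctional (lp.single 2 () ξ) (lp.single 2 () η)
  have := (isNormalEndo_iff.1 hφ _ hρ).ext_weyl (isNormalEndo_iff.1 hψ _ hρ) fun u => by simp [h]
  simpa [ampFunctional_apply, amp_single, lp.inner_single_left] using DFunLike.congr_fun this T

end WeylUniqueness

section RangeDecomposition

variable {𝕜 K L : Type*} [RCLike 𝕜] [NormedAddCommGroup K] [InnerProductSpace 𝕜 K]
  [CompleteSpace K] [NormedAddCommGroup L] [InnerProductSpace 𝕜 L]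

/-- The unitary `L ≃ K ⊕ (ran V)ᗮ` attached to an isometry `V : K → L`, inverse to
`(a, n) ↦ V a + n`. -/
def rangeDecomposition (V : K →ₗᵢ[𝕜] L) : L ≃ₗᵢ[𝕜] WithLp 2 (K × V.rangeᗮ) :=
  haveI : CompleteSpace V.range := V.isometry.isUniformInducing.isComplete_range.completeSpace_coe
  V.range.orthogonalDecomposition.trans
    (LinearIsometryEquiv.withLpProdCongr 2 V.equivRange.symm (LinearIsometryEquiv.refl 𝕜 _))

theorem rangeDecomposition_map (V : K →ₗᵢ[𝕜] L) (a : K) :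
    rangeDecomposition V (V a) = WithLp.toLp 2 (a, 0) := by
  have : CompleteSpace V.range := V.isometry.isUniformInducing.isComplete_range.completeSpace_coe
  have fst_eq : V.range.orthogonalProjectionOnto (V a) = V.equivRange a :=
    Submodule.orthogonalProjectionOnto_mem_subspace_eq_self (V.equivRange a)
  have snd_eq : V.rangeᗮ.orthogonalProjectionOnto (V a) = 0 :=
    Submodule.orthogonalProjectionOnto_orthogonal_apply_eq_zero (V.equivRange a).2
  simp [rangeDecomposition, Submodule.orthogonalDecomposition_apply, fst_eq, snd_eq]

variable [CompleteSpace L]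

theorem fst_rangeDecomposition (V : K →ₗᵢ[𝕜] L) (u : L) :
    (rangeDecomposition V u).fst = V.toContinuousLinearMap.adjoint u := by
  refine ext_inner_right 𝕜 fun a => ?_
  have h := (rangeDecomposition V).inner_map_map u (V a)
  rw [rangeDecomposition_map, WithLp.prod_inner_apply] at h
  simpa [ContinuousLinearMap.adjoint_inner_left] using h

theorem inner_snd_rangeDecomposition (V : K →ₗᵢ[𝕜] L) (u v : L) :
    ⟪(rangeDecomposition V u).snd, (rangeDecomposition V v).snd⟫_𝕜 =
      ⟪u, v⟫_𝕜 - ⟪V.toContinuousLinearMap.adjoint u, V.toContinuousLinearMap.adjoint v⟫_𝕜 := by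
  rw [← (rangeDecomposition V).inner_map_map u v, WithLp.prod_inner_apply,
    ← fst_rangeDecomposition, ← fst_rangeDecomposition]
  exact (add_sub_cancel_left _ _).symm

end RangeDecomposition

section ConjAmp

variable {𝕜 H G ι : Type*} [RCLike 𝕜] [NormedAddCommGroup H] [InnerProductSpace 𝕜 H]
  [CompleteSpace H] [NormedAddCommGroup G] [InnerProductSpace 𝕜 G] [CompleteSpace G]

/-- The `*`-homomorphism `T ↦ U⁻¹ (⨁ᵢ T) U` given by a unitary `U : H ≃ ℓ²(ι, G)`. -/
def conjAmp (U : H ≃ₗᵢ[𝕜] ℓ²(ι, G)) : (G →L[𝕜] G) →⋆ₐ[𝕜] (H →L[𝕜] H) :=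
  U.symm.conjStarAlgEquiv.toStarAlgHom.comp (ampHom 𝕜 G ι)

theorem conjAmp_apply (U : H ≃ₗᵢ[𝕜] ℓ²(ι, G)) (T : G →L[𝕜] G) (ξ : H) :
    conjAmp U T ξ = U.symm (amp ι T (U ξ)) :=
  rfl

theorem inner_conjAmp (U : H ≃ₗᵢ[𝕜] ℓ²(ι, G)) (T : G →L[𝕜] G) (ξ η : H) :
    ⟪ξ, conjAmp U T η⟫_𝕜 = ampFunctional (U ξ) (U η) T := by
  rw [conjAmp_apply, ← U.inner_map_map, U.apply_symm_apply, ampFunctional_apply]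

end ConjAmp

section ConjAmpNormal

variable {H G ι : Type*} [NormedAddCommGroup H] [InnerProductSpace ℂ H]
  [CompleteSpace H] [NormedAddCommGroup G] [InnerProductSpace ℂ G] [CompleteSpace G]

theorem IsNormalFunctional.comp_conjAmp {ρ : (H →L[ℂ] H) →ₗ[ℂ] ℂ} (hρ : IsNormalFunctional ρ)
    (U : H ≃ₗᵢ[ℂ] ℓ²(ι, G)) :
    IsNormalFunctional (ρ ∘ₗ (conjAmp U : (G →L[ℂ] G) →ₗ[ℂ] (H →L[ℂ] H))) := by
  obtain ⟨ξ, η, rfl⟩ := isNormalFunctional_iff.1 hρ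
  have hasSum_norm_sq (x : H) : HasSum (fun i => ‖U x i‖ ^ 2) (‖x‖ ^ 2) := by
    simpa using lp.hasSum_norm (p := 2) (by norm_num) (U x)
  let coords (ζ : ℓ²(ℕ, H)) : ℓ²(ℕ × ι, G) :=
    ⟨fun p => U (ζ p.1) p.2, memℓp_two_iff.2 <|
      (summable_prod_of_nonneg fun p => sq_nonneg _).2
        ⟨fun n => (hasSum_norm_sq (ζ n)).summable,
          (summable_norm_sq ζ).congr fun n => (hasSum_norm_sq (ζ n)).tsum_eq.symm⟩⟩
  have hcomp : ampFunctional ξ η ∘ₗ (conjAmp U : (G →L[ℂ] G) →ₗ[ℂ] (H →L[ℂ] H)) =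
      ampFunctional (coords ξ) (coords η) := LinearMap.ext fun T => by
    refine HasSum.unique (hasSum_ampFunctional ξ η (conjAmp U T)) ?_
    refine (hasSum_ampFunctional (coords ξ) (coords η) T).prod_fiberwise fun n => ?_
    rw [inner_conjAmp]
    exact hasSum_ampFunctional (U (ξ n)) (U (η n)) T
  rw [hcomp]
  exact isNormalFunctional_ampFunctional _ _

end ConjAmpNormal

section CCRHom

variable {ι K L : Type*} [NormedAddCommGroup K] [InnerProductSpace ℂ K] [CompleteSpace K]
  [NormedAddCommGroup L] [InnerProductSpace ℂ L] [CompleteSpace L]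

/-- The unitary `Γ(L) ≃ Γ(K) ⊗ Γ((ran V)ᗮ)` attached to an isometry `V : K → L`. The tensor product
is encoded as `ℓ²(ι, Γ(K))`, with `ι` the index set of a Hilbert basis `b` of `Γ((ran V)ᗮ)`. -/
def fockTensorEquiv (V : K →ₗᵢ[ℂ] L) (b : HilbertBasis ι ℂ (Fock V.rangeᗮ)) :
    Fock L ≃ₗᵢ[ℂ] ℓ²(ι, Fock K) :=
  (exists_fock_linearIsometryEquiv_tensorVec b (rangeDecomposition V)).choose

theorem fockTensorEquiv_expVec (V : K →ₗᵢ[ℂ] L) (b : HilbertBasis ι ℂ (Fock V.rangeᗮ)) (u : L) :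
    fockTensorEquiv V b (expVec u) = tensorVec b (expVec (rangeDecomposition V u).snd)
      (expVec (V.toContinuousLinearMap.adjoint u)) := by
  rw [← fst_rangeDecomposition]
  exact (exists_fock_linearIsometryEquiv_tensorVec b (rangeDecomposition V)).choose_spec u

/-- The unital `*`-homomorphism `B(Γ(K)) → B(Γ(L))`, `W(u) ↦ W(V u)`, attached to an isometry
`V : K → L`: it is `T ↦ T ⊗ 1` under the identification `Γ(L) ≃ Γ(K) ⊗ Γ((ran V)ᗮ)` made with the
help of the Hilbert basis `b`. -/
def ccrHom (V : K →ₗᵢ[ℂ] L) (b : HilbertBasis ι ℂ (Fock V.rangeᗮ)) :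
    (Fock K →L[ℂ] Fock K) →⋆ₐ[ℂ] (Fock L →L[ℂ] Fock L) :=
  conjAmp (fockTensorEquiv V b)

theorem ccrHom_weyl (V : K →ₗᵢ[ℂ] L) (b : HilbertBasis ι ℂ (Fock V.rangeᗮ)) (k : K) :
    ccrHom V b (weyl k) = weyl (V k) := by
  refine clm_ext_expVec fun v => ?_
  have snd_eq : (rangeDecomposition V (V k + v)).snd = (rangeDecomposition V v).snd := by
    simp [rangeDecomposition_map]
  have adjoint_eq : V.toContinuousLinearMap.adjoint (V k) = k :=
    DFunLike.congr_fun V.adjoint_comp_self k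
  have inner_eq : ⟪V k, v⟫_ℂ = ⟪k, V.toContinuousLinearMap.adjoint v⟫_ℂ :=
    (V.toContinuousLinearMap.adjoint_inner_right k v).symm
  rw [ccrHom, conjAmp_apply, LinearIsometryEquiv.symm_apply_eq, weyl_expVec, map_smul,
    fockTensorEquiv_expVec, fockTensorEquiv_expVec, amp_tensorVec, weyl_expVec, tensorVec_smul,
    snd_eq, map_add, adjoint_eq, inner_eq, V.norm_map]

theorem inner_expVec_ccrHom (V : K →ₗᵢ[ℂ] L) (b : HilbertBasis ι ℂ (Fock V.rangeᗮ))
    (T : Fock K →L[ℂ] Fock K) (u v : L) :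
    ⟪expVec u, ccrHom V b T (expVec v)⟫_ℂ =
      Complex.exp (⟪u, v⟫_ℂ -
          ⟪V.toContinuousLinearMap.adjoint u, V.toContinuousLinearMap.adjoint v⟫_ℂ) *
        ⟪expVec (V.toContinuousLinearMap.adjoint u),
          T (expVec (V.toContinuousLinearMap.adjoint v))⟫_ℂ := by
  rw [ccrHom, inner_conjAmp, ampFunctional_apply, fockTensorEquiv_expVec, fockTensorEquiv_expVec,
    amp_tensorVec, inner_tensorVec, inner_expVec, inner_snd_rangeDecomposition]

theorem isNormalEndo_ccrHom (V : K →ₗᵢ[ℂ] K) (b : HilbertBasis ι ℂ (Fock V.rangeᗮ)) :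
    IsNormalEndo (ccrHom V b).toNonUnitalStarAlgHom :=
  isNormalEndo_iff.2 fun _ hρ => hρ.comp_conjAmp _

end CCRHom

section WeakContinuity

open Filter Topology

theorem continuous_clm_apply_of_denseRange {𝕜 α E F X : Type*} [NontriviallyNormedField 𝕜]
    [NormedAddCommGroup E] [NormedSpace 𝕜 E] [NormedAddCommGroup F] [NormedSpace 𝕜 F]
    [TopologicalSpace X] {f : α → E} (hf : DenseRange (Finsupp.linearCombination 𝕜 f))
    {A : X → E →L[𝕜] F} {C : ℝ} (hA : ∀ x, ‖A x‖ ≤ C) (h : ∀ a, Continuous fun x => A x (f a))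
    (e : E) : Continuous fun x => A x e := by
  have hequi : Equicontinuous fun x => ⇑(A x) :=
    (LipschitzWith.uniformEquicontinuous _ C.toNNReal fun x =>
      (A x).lipschitz.weaken (NNReal.coe_le_coe.1 ((hA x).trans C.le_coe_toNNReal))).equicontinuous
  refine continuous_iff_continuousAt.2 fun x => ?_
  refine isClosed_property hf (hequi.isClosed_setOfPred_tendsto (A x).continuous) (fun c => ?_) e
  suffices Continuous fun y => A y (Finsupp.linearCombination 𝕜 f c) from this.tendsto x
  simp only [Finsupp.linearCombination_apply, Finsupp.sum, map_sum, map_smul]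
  fun_prop

theorem continuous_inner_clm_of_denseRange {𝕜 α E X : Type*} [RCLike 𝕜] [NormedAddCommGroup E]
    [InnerProductSpace 𝕜 E] [TopologicalSpace X] {f : α → E}
    (hf : DenseRange (Finsupp.linearCombination 𝕜 f)) {A : X → E →L[𝕜] E} {C : ℝ}
    (hA : ∀ x, ‖A x‖ ≤ C) (h : ∀ a b, Continuous fun x => ⟪f a, A x (f b)⟫_𝕜) (ξ η : E) :
    Continuous fun x => ⟪ξ, A x η⟫_𝕜 := by
  have continuous_inner_left (a : α) : Continuous fun x => ⟪f a, A x η⟫_𝕜 := by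
    refine continuous_clm_apply_of_denseRange hf (A := fun x => innerSL 𝕜 (f a) ∘L A x)
      (C := ‖f a‖ * C) (fun x => ?_) (h a) η
    refine (ContinuousLinearMap.opNorm_comp_le _ _).trans ?_
    rw [innerSL_apply_norm]
    gcongr
    exact hA x
  have continuous_inner_swap : Continuous fun x => innerSL 𝕜 (A x η) ξ := by
    refine continuous_clm_apply_of_denseRange hf (C := C * ‖η‖) (fun x => ?_) (fun a => ?_) ξ
    · rw [innerSL_apply_norm]
      exact (A x).le_of_opNorm_le (hA x) η
    · simpa using (continuous_inner_left a).star
  simpa using continuous_inner_swap.star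

theorem IsNormalFunctional.continuous_apply {H X : Type*} [NormedAddCommGroup H]
    [InnerProductSpace ℂ H] [TopologicalSpace X] {ρ : (H →L[ℂ] H) →ₗ[ℂ] ℂ}
    (hρ : IsNormalFunctional ρ) {A : X → H →L[ℂ] H} {C : ℝ} (hA : ∀ x, ‖A x‖ ≤ C)
    (h : ∀ ξ η, Continuous fun x => ⟪ξ, A x η⟫_ℂ) : Continuous fun x => ρ (A x) := by
  obtain ⟨ξ, η, hρ⟩ := hρ
  simp only [hρ]
  have hsummable : Summable fun n => ‖ξ n‖ * ‖η n‖ :=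
    lp.summable_mul (by simpa using Real.HolderConjugate.two_two) ξ η
  refine continuous_tsum (fun n => h _ _) (hsummable.mul_left C) fun n x => ?_
  calc ‖⟪ξ n, A x (η n)⟫_ℂ‖ ≤ ‖ξ n‖ * ‖A x (η n)‖ := norm_inner_le_norm _ _
    _ ≤ ‖ξ n‖ * (C * ‖η n‖) := by gcongr; exact (A x).le_of_opNorm_le (hA x) _
    _ = C * (‖ξ n‖ * ‖η n‖) := by ring

theorem continuous_expVec {K : Type*} [NormedAddCommGroup K] [InnerProductSpace ℂ K] :
    Continuous (expVec : K → Fock K) := by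
  refine continuous_iff_continuousAt.2 fun u => tendsto_iff_norm_sub_tendsto_zero.2 ?_
  have norm_sub_eq (v : K) : ‖expVec v - expVec u‖ =
      √(Complex.exp ⟪v, v⟫_ℂ - Complex.exp ⟪v, u⟫_ℂ -
        (Complex.exp ⟪u, v⟫_ℂ - Complex.exp ⟪u, u⟫_ℂ)).re := by
    simp only [norm_eq_sqrt_re_inner (𝕜 := ℂ), inner_sub_left, inner_sub_right, inner_expVec,
      RCLike.re_to_complex]
    congr 2
    ring
  simp only [norm_sub_eq]
  exact Continuous.tendsto' (by fun_prop) _ _ (by simp)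

end WeakContinuity

section Cone

theorem exists_continuous_sub_eq_of_mem_span {E : Type*} [AddCommGroup E] [Module ℝ E]
    [TopologicalSpace E] [IsTopologicalAddGroup E] [ContinuousSMul ℝ E] [T2Space E]
    [FiniteDimensional ℝ E] (C : PointedCone ℝ E) :
    ∃ p q : Submodule.span ℝ (C : Set E) → E, Continuous p ∧ Continuous q ∧ p 0 = 0 ∧ q 0 = 0 ∧
      (∀ z, p z ∈ C) ∧ (∀ z, q z ∈ C) ∧ ∀ z, z = p z - q z := by
  obtain ⟨f, hf, hspan, hindep⟩ := Submodule.exists_fun_fin_finrank_span_eq ℝ (C : Set E)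
  let b := (Module.Basis.span hindep).map (LinearEquiv.ofEq _ _ hspan)
  have continuous_coord (i) : Continuous fun z => b.repr z i :=
    (b.coord i).continuous_of_finiteDimensional
  have sum_mem (g : Fin _ → ℝ) (hg : ∀ i, 0 ≤ g i) : ∑ i, g i • f i ∈ C :=
    C.sum_mem fun i _ => C.smul_mem (hg i) (hf i)
  refine ⟨fun z => ∑ i, (b.repr z i)⁺ • f i, fun z => ∑ i, (b.repr z i)⁻ • f i,
    by simp only [posPart]; fun_prop, by simp only [negPart]; fun_prop, by simp, by simp,
    fun z => sum_mem _ fun i => posPart_nonneg _, fun z => sum_mem _ fun i => negPart_nonneg _,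
    fun z => ?_⟩
  simp only [← Finset.sum_sub_distrib, ← sub_smul, posPart_sub_negPart]
  conv_lhs => rw [← b.sum_repr z]
  simp [b]

theorem exists_continuous_add_eq_add {E : Type*} [AddCommGroup E] [Module ℝ E]
    [TopologicalSpace E] [IsTopologicalAddGroup E] [ContinuousSMul ℝ E] [T2Space E]
    [FiniteDimensional ℝ E] {C : ProperCone ℝ E} (x : C) :
    ∃ a b : C → C, Continuous a ∧ Continuous b ∧ a x = 0 ∧ b x = 0 ∧
      ∀ y, x + a y = y + b y := by
  obtain ⟨p, q, hp, hq, hp0, hq0, hpC, hqC, hpq⟩ :=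
    exists_continuous_sub_eq_of_mem_span C.toSubmodule
  let δ (y : C) : Submodule.span ℝ (C : Set E) :=
    ⟨y - x, Submodule.sub_mem _ (Submodule.subset_span y.2) (Submodule.subset_span x.2)⟩
  have hδ : Continuous δ := by fun_prop
  have hδx : δ x = 0 := Subtype.ext (sub_self _)
  refine ⟨fun y => ⟨p (δ y), hpC _⟩, fun y => ⟨q (δ y), hqC _⟩, (hp.comp hδ).subtype_mk _,
    (hq.comp hδ).subtype_mk _, Subtype.ext ?_, Subtype.ext ?_, fun y => Subtype.ext ?_⟩
  · exact (congrArg p hδx).trans hp0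
  · exact (congrArg q hδx).trans hq0
  · exact (add_comm _ _).trans (sub_eq_sub_iff_add_eq_add.1 (hpq (δ y))).symm

variable {d : ℕ} {P : ProperCone ℝ (EuclideanSpace ℝ (Fin d))} {K : Type*}
  [NormedAddCommGroup K] [InnerProductSpace ℂ K] {V : P → K →L[ℂ] K}

theorem IsIsometricRep.map_zero (hV : IsIsometricRep P V) (u : K) : V 0 u = u := by
  have h := DFunLike.congr_fun (hV.map_add 0 0) u
  rw [add_zero] at h
  exact ((hV.isometry 0).injective h).symm

/-- The operator `V x` of an isometric representation, bundled as a linear isometry. -/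
def IsIsometricRep.toLinearIsometry (hV : IsIsometricRep P V) (x : P) : K →ₗᵢ[ℂ] K :=
  ⟨V x, (hV.isometry x).norm_map_of_map_zero (_root_.map_zero _)⟩

variable [CompleteSpace K]

theorem IsIsometricRep.norm_adjoint_add_sub_le (hV : IsIsometricRep P V) (x h : P) (u : K) :
    ‖(V (x + h)).adjoint u - (V x).adjoint u‖ ≤ ‖V h u - u‖ := by
  have norm_adjoint_le (y : P) (v : K) : ‖(V y).adjoint v‖ ≤ ‖v‖ := by
    have h : ‖(V y).adjoint‖ ≤ 1 := by
      rw [LinearIsometryEquiv.norm_map]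
      exact (hV.toLinearIsometry y).norm_toContinuousLinearMap_le
    simpa using (V y).adjoint.le_of_opNorm_le h v
  have adjoint_comp_self : (V h).adjoint (V h u) = u :=
    DFunLike.congr_fun (hV.toLinearIsometry h).adjoint_comp_self u
  calc ‖(V (x + h)).adjoint u - (V x).adjoint u‖
      = ‖(V x).adjoint ((V h).adjoint (u - V h u))‖ := by
        rw [add_comm, hV.map_add, ContinuousLinearMap.adjoint_comp, map_sub, adjoint_comp_self,
          map_sub, ContinuousLinearMap.comp_apply]
    _ ≤ ‖V h u - u‖ := by
        rw [norm_sub_rev]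
        exact (norm_adjoint_le x _).trans (norm_adjoint_le h _)

theorem IsIsometricRep.continuous_adjoint (hV : IsIsometricRep P V) (u : K) :
    Continuous fun x => (V x).adjoint u := by
  refine continuous_iff_continuousAt.2 fun x => tendsto_iff_norm_sub_tendsto_zero.2 ?_
  obtain ⟨a, b, ha, hb, hax, hbx, hab⟩ := exists_continuous_add_eq_add x
  have norm_sub_le (y : P) : ‖(V y).adjoint u - (V x).adjoint u‖ ≤
      ‖V (b y) u - u‖ + ‖V (a y) u - u‖ := by
    have hy := hV.norm_adjoint_add_sub_le y (b y) u
    have hx := hV.norm_adjoint_add_sub_le x (a y) u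
    rw [hab] at hx
    rw [norm_sub_rev] at hy
    exact (norm_sub_le_norm_sub_add_norm_sub _ _ _).trans (add_le_add hy hx)
  have continuous_bound : Continuous fun y => ‖V (b y) u - u‖ + ‖V (a y) u - u‖ :=
    (((hV.continuous u).comp hb).sub continuous_const).norm.add
      (((hV.continuous u).comp ha).sub continuous_const).norm
  exact squeeze_zero (fun _ => norm_nonneg _) norm_sub_le
    (continuous_bound.tendsto' _ _ (by simp [hax, hbx, hV.map_zero]))

end Cone

section CCRFlow

variable {d : ℕ} {P : ProperCone ℝ (EuclideanSpace ℝ (Fin d))} {K : Type*}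
  [NormedAddCommGroup K] [InnerProductSpace ℂ K] [CompleteSpace K] {V : P → K →L[ℂ] K}

/-- The CCR flow associated to an isometric representation `V`. Its member at `x` is defined from
an arbitrary Hilbert basis of `Γ((ran V x)ᗮ)`; being determined by `W(u) ↦ W(V x u)`, it does not
depend on this choice. -/
def ccrFlow (hV : IsIsometricRep P V) (x : P) :
    (Fock K →L[ℂ] Fock K) →⋆ₙₐ[ℂ] (Fock K →L[ℂ] Fock K) :=
  (ccrHom (hV.toLinearIsometry x)
    (exists_hilbertBasis ℂ (Fock (hV.toLinearIsometry x).rangeᗮ)).choose_spec.choose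
    ).toNonUnitalStarAlgHom

theorem ccrFlow_weyl (hV : IsIsometricRep P V) (x : P) (u : K) :
    ccrFlow hV x (weyl u) = weyl (V x u) :=
  ccrHom_weyl _ _ u

theorem inner_expVec_ccrFlow (hV : IsIsometricRep P V) (x : P) (T : Fock K →L[ℂ] Fock K)
    (u v : K) :
    ⟪expVec u, ccrFlow hV x T (expVec v)⟫_ℂ =
      Complex.exp (⟪u, v⟫_ℂ - ⟪(V x).adjoint u, (V x).adjoint v⟫_ℂ) *
        ⟪expVec ((V x).adjoint u), T (expVec ((V x).adjoint v))⟫_ℂ :=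
  inner_expVec_ccrHom _ _ T u v

theorem isNormalEndo_ccrFlow (hV : IsIsometricRep P V) (x : P) : IsNormalEndo (ccrFlow hV x) :=
  isNormalEndo_ccrHom _ _

theorem ccrFlow_zero (hV : IsIsometricRep P V) : ccrFlow hV 0 = NonUnitalStarAlgHom.id ℂ _ :=
  (isNormalEndo_ccrFlow hV 0).ext_weyl (isNormalEndo_id _) fun u => by
    rw [ccrFlow_weyl, hV.map_zero, NonUnitalStarAlgHom.coe_id, id]

theorem ccrFlow_add (hV : IsIsometricRep P V) (x y : P) :
    ccrFlow hV (x + y) = (ccrFlow hV x).comp (ccrFlow hV y) :=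
  (isNormalEndo_ccrFlow hV _).ext_weyl
    ((isNormalEndo_ccrFlow hV x).comp (isNormalEndo_ccrFlow hV y)) fun u => by
      rw [NonUnitalStarAlgHom.comp_apply, ccrFlow_weyl, ccrFlow_weyl, ccrFlow_weyl, hV.map_add,
        ContinuousLinearMap.comp_apply]

theorem continuous_ccrFlow (hV : IsIsometricRep P V) {ρ : (Fock K →L[ℂ] Fock K) →ₗ[ℂ] ℂ}
    (hρ : IsNormalFunctional ρ) (T : Fock K →L[ℂ] Fock K) :
    Continuous fun x => ρ (ccrFlow hV x T) := by
  have norm_le (x : P) : ‖ccrFlow hV x T‖ ≤ ‖T‖ :=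
    NonUnitalStarAlgHom.norm_apply_le (ccrFlow hV x) T
  refine hρ.continuous_apply norm_le <|
    continuous_inner_clm_of_denseRange denseRange_expComb norm_le fun u v => ?_
  simp only [inner_expVec_ccrFlow]
  have hu := hV.continuous_adjoint u
  have hv := hV.continuous_adjoint v
  have hexp := continuous_expVec (K := K)
  fun_prop

theorem isE0Semigroup_ccrFlow (hV : IsIsometricRep P V) : IsE0Semigroup P (ccrFlow hV) where
  normal := isNormalEndo_ccrFlow hV
  map_zero T := by rw [ccrFlow_zero, NonUnitalStarAlgHom.coe_id, id]
  map_add x y T := by rw [ccrFlow_add, NonUnitalStarAlgHom.comp_apply]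
  continuous _ hρ T := continuous_ccrFlow hV hρ T
  unital _ := map_one (ccrHom _ _)

end CCRFlow

end CCR

end

theorem mainTheorem10_general {d : ℕ} (P : ProperCone ℝ (EuclideanSpace ℝ (Fin d)))
    {K : Type*} [NormedAddCommGroup K] [InnerProductSpace ℂ K] [CompleteSpace K]
    (V : P → K →L[ℂ] K) (hV : CCR.IsIsometricRep P V) :
    ∃! α : P → (CCR.Fock K →L[ℂ] CCR.Fock K) →⋆ₙₐ[ℂ] (CCR.Fock K →L[ℂ] CCR.Fock K),
      CCR.IsE0Semigroup P α ∧
        ∀ (x : P) (u : K), α x (CCR.weyl u) = CCR.weyl (V x u) := by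
  refine ⟨CCR.ccrFlow hV, ⟨CCR.isE0Semigroup_ccrFlow hV, CCR.ccrFlow_weyl hV⟩, ?_⟩
  rintro β ⟨hβ, hβ_weyl⟩
  funext x
  exact (hβ.normal x).ext_weyl (CCR.isNormalEndo_ccrFlow hV x) fun u => by
    rw [hβ_weyl, CCR.ccrFlow_weyl]

theorem mainTheorem10 {d : ℕ} (P : ProperCone ℝ (EuclideanSpace ℝ (Fin d)))
    (hspan : ∀ z : EuclideanSpace ℝ (Fin d), ∃ x ∈ P, ∃ y ∈ P, z = x - y)
    (hpointed : ∀ x ∈ P, -x ∈ P → x = 0)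
    {K : Type*} [NormedAddCommGroup K] [InnerProductSpace ℂ K] [CompleteSpace K]
    [TopologicalSpace.SeparableSpace K]
    (V : P → K →L[ℂ] K) (hV : CCR.IsIsometricRep P V) :
    ∃! α : P → (CCR.Fock K →L[ℂ] CCR.Fock K) →⋆ₙₐ[ℂ] (CCR.Fock K →L[ℂ] CCR.Fock K),
      CCR.IsE0Semigroup P α ∧
        ∀ (x : P) (u : K), α x (CCR.weyl u) = CCR.weyl (V x u) :=
  mainTheorem10_general P V hV
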